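/- Let $n\geq 3$, $m\geq 0$ and $s\in\{m+2,\dots,2m+3\}$ be integers, and let $\varphi\colon \mathcal O_{\mathbb P^s}^{\oplus n+m}\to\mathcal O_{\mathbb P^s}(1)^{\oplus n}$ be a general morphism over $\mathbb C$ (that is, $\varphi$ lies in a suitable nonempty Zariski open subset of the space of all such morphisms), given by an $n\times(n+m)$ matrix $M$ of linear forms on $V_{s+1}=\mathbb C^{s+1}$; write $M_v$ for its value at $v\in V_{s+1}$, and $D_k(\varphi)=\{[v]\in\mathbb P^s : \operatorname{rank} M_v\leq k\}$. Then $D_{n-2}(\varphi)=\emptyset$. Put $S=D_{n-1}(\varphi)\subset\mathbb P^s$ and let $\psi\colon S\to\mathbb P^{n-1}$ send $[v]$ to $[\alpha_v]$, where $\alpha_v$ spans the one-dimensional space $\ker(M_v^t)\subset V_n=\mathbb C^n$. Let $\operatorname{Gr}(k,N)$ be the Grassmannian of $k$-dimensional subspaces of $V_N=\mathbb C^N$, and let \[ Z=\{(\rho_1,\rho_2,\rho_3) : a^tM_u b=0 \text{ for all } a\in\rho_1,\ u\in\rho_2,\ b\in\rho_3\}\subset \operatorname{Gr}(2,n)\times\operatorname{Gr}(2,s+1)\times\operatorname{Gr}(n+m-2,n+m),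 \] with projection $\pi_Z\colon Z\to\operatorname{Gr}(2,n)\times\operatorname{Gr}(2,s+1)$. Then: (1) If $n>2s-3m-1$, the map $\pi_Z$ is injective. (2) There exists a line $\ell\subset S\subset\mathbb P^s$ such that $\psi(\ell)$ is a line in $\mathbb P^{n-1}$ if and only if $\pi_Z$ has an $(n+m-2)$-dimensional linear fibre, i.e. a fibre $\pi_Z^{-1}(\rho_1,\rho_2)$ that, viewed in $\operatorname{Gr}(n+m-2,n+m)$, is mapped by the Plücker embedding onto an $(n+m-2)$-dimensional linear subspace of $\mathbb P(\bigwedge^{n+m-2}V_{n+m})$. -/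

import Mathlib

open scoped LinearAlgebra.Projectivization Matrix

noncomputable section

namespace HilbSq

/-- The coordinate space `V_N = ℂ^N`. -/
abbrev V (N : ℕ) : Type := Fin N → ℂ

/-- The projective space `ℙ^{N-1} = ℙ(V_N)` of one-dimensional subspaces of `V_N`
(closed points). -/
abbrev PV (N : ℕ) : Type := ℙ ℂ (V N)

/-- A map of vector bundles `𝒪^{n+m} → 𝒪(1)^n` on `ℙ^s`, that is, an `n × (n+m)` matrix of
linear forms in `s+1` variables. -/
abbrev LinMatrix (n m s : ℕ) : Type :=
  Matrix (Fin n) (Fin (n + m)) (Module.Dual ℂ (V (s + 1)))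

/-- The scalar matrix `M_v`: the matrix of linear forms evaluated at `v ∈ V_{s+1}`. -/
def evalAt {n m s : ℕ} (φ : LinMatrix n m s) (v : V (s + 1)) :
    Matrix (Fin n) (Fin (n + m)) ℂ :=
  Matrix.of fun i j => φ i j v

/-- The coefficients of the linear forms occurring in `φ`: the coordinates of `φ` in the affine
space of all matrices of linear forms. -/
def coeffs {n m s : ℕ} (φ : LinMatrix n m s) : Fin n × Fin (n + m) × Fin (s + 1) → ℂ :=
  fun t => φ t.1 t.2.1 (Pi.single t.2.2 1)

/-- `P` holds for a general `φ`: it holds on a nonempty Zariski open subset of the affine space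
of all `φ` (equivalently, on the complement of the zero locus of some nonzero polynomial in the
coefficients). -/
def ForGeneral {n m s : ℕ} (P : LinMatrix n m s → Prop) : Prop :=
  ∃ p : MvPolynomial (Fin n × Fin (n + m) × Fin (s + 1)) ℂ, p ≠ 0 ∧
    ∀ φ : LinMatrix n m s, MvPolynomial.eval (coeffs φ) p ≠ 0 → P φ

/-- The degeneracy locus `D_k(φ) = {[v] ∈ ℙ^s | rank M_v ≤ k}`. -/
def degeneracyLocus {n m s : ℕ} (φ : LinMatrix n m s) (k : ℕ) : Set (PV (s + 1)) :=
  {x | ∀ v ∈ x.submodule, (evalAt φ v).rank ≤ k}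

/-- The first degeneracy locus `S = D_{n-1}(φ)`. -/
def S {n m s : ℕ} (φ : LinMatrix n m s) : Set (PV (s + 1)) :=
  degeneracyLocus φ (n - 1)

/-- The kernel `{α ∈ V_n | M_vᵗ α = 0}`, for a point `x = [v]` of `ℙ^s`. -/
def kerAt {n m s : ℕ} (φ : LinMatrix n m s) (x : PV (s + 1)) : Submodule ℂ (V n) where
  carrier := {a | ∀ v ∈ x.submodule, (evalAt φ v)ᵀ *ᵥ a = 0}
  zero_mem' := by
    intro v _
    simp
  add_mem' := by
    intro a b ha hb v hv
    rw [Matrix.mulVec_add, ha v hv, hb v hv, add_zero]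
  smul_mem' := by
    intro c a ha v hv
    rw [Matrix.mulVec_smul, ha v hv, smul_zero]

theorem evalAt_smul {n m s : ℕ} (φ : LinMatrix n m s) (c : ℂ) (v : V (s + 1)) :
    evalAt φ (c • v) = c • evalAt φ v := by
  ext i j
  simp [evalAt]

theorem rank_smul_le {n m : ℕ} (c : ℂ) (A : Matrix (Fin n) (Fin m) ℂ) :
    (c • A).rank ≤ A.rank := by
  have h : c • A = A * (c • (1 : Matrix (Fin m) (Fin m) ℂ)) := by simp
  rw [h]
  exact Matrix.rank_mul_le_left _ _

theorem mem_degeneracyLocus_iff {n m s : ℕ} (φ : LinMatrix n m s) (k : ℕ) (x : PV (s + 1)) :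
    x ∈ degeneracyLocus φ k ↔ (evalAt φ x.rep).rank ≤ k := by
  constructor
  · intro h
    apply h
    rw [Projectivization.submodule_eq]
    exact Submodule.mem_span_singleton_self _
  · intro h v hv
    rw [Projectivization.submodule_eq, Submodule.mem_span_singleton] at hv
    obtain ⟨c, rfl⟩ := hv
    rw [evalAt_smul]
    exact (rank_smul_le _ _).trans h

theorem kerAt_eq {n m s : ℕ} (φ : LinMatrix n m s) (x : PV (s + 1)) :
    kerAt φ x = LinearMap.ker (Matrix.mulVecLin (evalAt φ x.rep)ᵀ) := by
  ext a
  rw [LinearMap.mem_ker, Matrix.mulVecLin_apply]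
  constructor
  · intro h
    apply h
    rw [Projectivization.submodule_eq]
    exact Submodule.mem_span_singleton_self _
  · intro h v hv
    rw [Projectivization.submodule_eq, Submodule.mem_span_singleton] at hv
    obtain ⟨c, rfl⟩ := hv
    rw [evalAt_smul, Matrix.transpose_smul, Matrix.smul_mulVec, h, smul_zero]

/-- When `D_{n-2}(φ)` is empty, the kernel of `M_vᵗ` is one-dimensional at each point of `S`. -/
theorem finrank_kerAt {n m s : ℕ} (φ : LinMatrix n m s) (h : degeneracyLocus φ (n - 2) = ∅)
    (x : S φ) : Module.finrank ℂ (kerAt φ x.1) = 1 := by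
  have h1 : (evalAt φ x.1.rep).rank ≤ n - 1 := (mem_degeneracyLocus_iff φ _ _).1 x.2
  have h2 : ¬ (evalAt φ x.1.rep).rank ≤ n - 2 := by
    rw [← mem_degeneracyLocus_iff, h]
    exact Set.notMem_empty _
  have h3 := LinearMap.finrank_range_add_finrank_ker (Matrix.mulVecLin (evalAt φ x.1.rep)ᵀ)
  rw [← kerAt_eq, Module.finrank_fin_fun] at h3
  have h4 : (evalAt φ x.1.rep)ᵀ.rank = (evalAt φ x.1.rep).rank := Matrix.rank_transpose _
  rw [Matrix.rank] at h4
  have key : ∀ r k t : ℕ, r ≤ n - 1 → ¬ r ≤ n - 2 → t + k = n → t = r → k = 1 := by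
    intro r k t
    omega
  exact key _ _ _ h1 h2 h3 h4

/-- The map `ψ : S → ℙ^{n-1}`, `[v] ↦ [α_v]`, where `α_v` spans the kernel of `M_vᵗ`. -/
def psi {n m s : ℕ} (φ : LinMatrix n m s) (h : degeneracyLocus φ (n - 2) = ∅)
    (x : S φ) : PV n :=
  Projectivization.mk'' (kerAt φ x.1) (finrank_kerAt φ h x)

/-- The Grassmannian of `k`-dimensional subspaces of `V_N` (closed points). -/
def Gr (k N : ℕ) : Type := {W : Submodule ℂ (V N) // Module.finrank ℂ W = k}

/-- The zero locus `Z` of `ω(a,u,b) = aᵗ M_u b` in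
`Gr(2,n) × Gr(2,s+1) × Gr(n+m-2,n+m)` (closed points). -/
def Z {n m s : ℕ} (φ : LinMatrix n m s) : Set (Gr 2 n × Gr 2 (s + 1) × Gr (n + m - 2) (n + m)) :=
  {P | ∀ a ∈ P.1.1, ∀ u ∈ P.2.1.1, ∀ b ∈ P.2.2.1, a ⬝ᵥ (evalAt φ u *ᵥ b) = 0}

/-- The projection `π_Z : Z → Gr(2,n) × Gr(2,s+1)`. -/
def piZ {n m s : ℕ} (φ : LinMatrix n m s) (P : Z φ) : Gr 2 n × Gr 2 (s + 1) :=
  (P.1.1, P.1.2.1)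

/-- `X` is a linear subspace of dimension `d` of the projective space `ℙ(E)`. -/
def IsLinearSubspace {E : Type*} [AddCommGroup E] [Module ℂ E] (d : ℕ) (X : Set (ℙ ℂ E)) : Prop :=
  ∃ U : Submodule ℂ E, Module.finrank ℂ U = d + 1 ∧ X = {x | x.submodule ≤ U}

/-- `X` is a line in the projective space `ℙ(E)`. -/
def IsLine {E : Type*} [AddCommGroup E] [Module ℂ E] (X : Set (ℙ ℂ E)) : Prop :=
  IsLinearSubspace 1 X

theorem finrank_range_exteriorPower {k N : ℕ} (W : Gr k N) :
    Module.finrank ℂ (LinearMap.range (exteriorPower.map k W.1.subtype)) = 1 := by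
  rw [LinearMap.finrank_range_of_inj
    (exteriorPower.map_injective_field (Submodule.subtype_injective _)),
    exteriorPower.finrank_eq, W.2, Nat.choose_self]

/-- The Plücker embedding `Gr(k,N) → ℙ(⋀^k V_N)`, `W ↦ ⋀^k W`. -/
def pluecker {k N : ℕ} (W : Gr k N) : ℙ ℂ (⋀[ℂ]^k (V N)) :=
  Projectivization.mk'' (LinearMap.range (exteriorPower.map k W.1.subtype))
    (finrank_range_exteriorPower W)

/-- The fibre of `π_Z` over `q = (ρ₁,ρ₂)`, a subset of `{q} × Gr(n+m-2,n+m)`, viewed inside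
`ℙ(⋀^{n+m-2} V_{n+m})` through the Plücker embedding of the last factor. -/
def fibreInPluecker {n m s : ℕ} (φ : LinMatrix n m s) (q : Gr 2 n × Gr 2 (s + 1)) :
    Set (ℙ ℂ (⋀[ℂ]^(n + m - 2) (V (n + m)))) :=
  (fun P : Z φ => pluecker P.1.2.2) '' (piZ φ ⁻¹' {q})

end HilbSq

end

/-! View `φ` as a trilinear form and attach to `(ρ₁, ρ₂)` the space `forms φ (ρ₁, ρ₂)` spanned by
the functionals `aᵗ M_u` with `a ∈ ρ₁`, `u ∈ ρ₂`. The fibre of `π_Z` over `(ρ₁, ρ₂)` consists of the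
`(n+m-2)`-dimensional subspaces of the common kernel of these functionals, so everything depends on
the dimension `r` of `forms`. If `r ≥ 2`, the fibre has at most one point. If `r = 1`, it consists
of the hyperplanes of an `(n+m-1)`-dimensional space, which the Plücker embedding maps onto a linear
`ℙ^{n+m-2}`, because in dimension `k + 1` every `k`-form is decomposable
(`isLinearSubspace_pluecker`). The case `r = 0` would put a plane in the kernel of `M_uᵗ`, against
`D_{n-2} = ∅`.

Part (2) needs only `D_{n-2} = ∅`. If `r = 1`, each `u ∈ ρ₂` kills some nonzero `a ∈ ρ₁` and
conversely, so `ψ` maps `ℙ(ρ₂)` onto `ℙ(ρ₁)`. If `ψ` maps a line onto a line, choose `u₁, u₂` on the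
first with independent images `a₁, a₂`; evaluating at `u₁ + u₂` gives a linear relation between the
two mixed functionals, so `r ≤ 1`.

Genericity enters through two parameter counts, both instances of `exists_vanishing_of_subspaces`:
one shows that `D_{n-2}` is empty, the other that `r ≥ 2` for every `(ρ₁, ρ₂)` under the bound in
(1). Each bad locus is covered by finitely many polynomial images of affine spaces of smaller
dimension, so it lies in a hypersurface. -/

namespace HilbSq

/-! ### Parameter counts: bad tensors lie in a hypersurface. -/

section Genericity

open MvPolynomial

/-- More polynomials than variables satisfy a nontrivial algebraic relation. -/
theorem exists_ne_zero_aeval_eq_zero {σ τ : Type} [Fintype σ] [Fintype τ]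
    (h : Fintype.card τ < Fintype.card σ) (f : σ → MvPolynomial τ ℂ) :
    ∃ p : MvPolynomial σ ℂ, p ≠ 0 ∧ aeval f p = 0 := by
  by_contra! hf
  have hind : AlgebraicIndependent ℂ f :=
    (injective_iff_map_eq_zero _).2 fun p hp => by_contra fun h0 => hf p h0 hp
  have := hind.cardinalMk_le_trdeg
  rw [MvPolynomial.trdeg_of_isDomain] at this
  simp only [Cardinal.mk_fintype, Cardinal.lift_natCast, Nat.cast_le] at this
  omega

/-- The image of a polynomial map from a smaller affine space lies in a hypersurface. -/
theorem exists_ne_zero_eval_eq_zero {σ τ : Type} [Fintype σ] [Fintype τ]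
    (h : Fintype.card τ < Fintype.card σ) (f : σ → MvPolynomial τ ℂ) :
    ∃ p : MvPolynomial σ ℂ, p ≠ 0 ∧ ∀ x : τ → ℂ, eval (fun i => eval x (f i)) p = 0 := by
  obtain ⟨p, hp, hp'⟩ := exists_ne_zero_aeval_eq_zero h f
  refine ⟨p, hp, fun x => ?_⟩
  have := congrArg (eval x) hp'
  rw [map_zero, aeval_def, algebraMap_eq] at this
  rw [← this, ← coe_eval₂Hom, ← RingHom.comp_apply]
  congr 1
  ext i <;> simp

variable {A A' B B' L τ ι κ : Type} [Fintype A] [Fintype A'] [Fintype B] [Fintype B']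
  [Fintype L] [Fintype τ] [Fintype ι] [Fintype κ]

/-- The free coordinates of a tensor whose `A × B` block is prescribed. -/
abbrev OffBlock (A A' B B' L : Type) : Type := (A' × L × B) ⊕ (A × L × B') ⊕ (A' × L × B')

/-- Tensors that become, after unipotent changes of coordinates, tensors with `A × B` block
parametrized by `τ`, lie in a hypersurface if there are few parameters. -/
theorem exists_vanishing_of_block_sum (F : A → B → L → MvPolynomial τ ℂ)
    (h : Fintype.card A * Fintype.card A' + Fintype.card B * Fintype.card B' + Fintype.card τ <
      Fintype.card A * Fintype.card B * Fintype.card L) :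
    ∃ P : MvPolynomial ((A ⊕ A') × L × (B ⊕ B')) ℂ, P ≠ 0 ∧
      ∀ (c : (A ⊕ A') × L × (B ⊕ B') → ℂ) (t : A → A' → ℂ) (u : B → B' → ℂ) (x : τ → ℂ),
        (∀ r r' l, c (.inl r, l, .inl r') + ∑ k, u r' k * c (.inl r, l, .inr k)
          + ∑ j, t r j * c (.inr j, l, .inl r')
          + ∑ j, ∑ k, t r j * u r' k * c (.inr j, l, .inr k) = eval x (F r r' l)) →
        eval c P = 0 := by
  let σ : Type := (A × A') ⊕ (B × B') ⊕ τ ⊕ OffBlock A A' B B' L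
  let T (r : A) (j : A') : MvPolynomial σ ℂ := X (.inl (r, j))
  let U (r : B) (j : B') : MvPolynomial σ ℂ := X (.inr (.inl (r, j)))
  let C (o : OffBlock A A' B B' L) : MvPolynomial σ ℂ := X (.inr (.inr (.inr o)))
  -- Solve the block equation for the `A × B` block: the whole tensor is then a polynomial in `t`,
  -- `u`, `x` and the entries off the block.
  let f : (A ⊕ A') × L × (B ⊕ B') → MvPolynomial σ ℂ := fun
    | (.inl r, l, .inl r') => rename (fun i => .inr (.inr (.inl i))) (F r r' l)
        - ∑ k, U r' k * C (.inr (.inl (r, l, k)))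
        - ∑ j, T r j * C (.inl (j, l, r'))
        - ∑ j, ∑ k, T r j * U r' k * C (.inr (.inr (j, l, k)))
    | (.inr j, l, .inl r') => C (.inl (j, l, r'))
    | (.inl r, l, .inr k) => C (.inr (.inl (r, l, k)))
    | (.inr j, l, .inr k) => C (.inr (.inr (j, l, k)))
  obtain ⟨P, hP, hP'⟩ := exists_ne_zero_eval_eq_zero (τ := σ) (by
    simp only [σ, Fintype.card_sum, Fintype.card_prod]
    nlinarith [h]) f
  refine ⟨P, hP, fun c t u x hc => ?_⟩
  let y : σ → ℂ := fun
    | .inl (r, j) => t r j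
    | .inr (.inl (r, j)) => u r j
    | .inr (.inr (.inl i)) => x i
    | .inr (.inr (.inr (.inl (j, l, r')))) => c (.inr j, l, .inl r')
    | .inr (.inr (.inr (.inr (.inl (r, l, k))))) => c (.inl r, l, .inr k)
    | .inr (.inr (.inr (.inr (.inr (j, l, k))))) => c (.inr j, l, .inr k)
  rw [← hP' y]
  congr 2
  funext i
  rcases i with ⟨r | j, l, r' | k⟩
  · have hx : eval y (rename (fun i => (.inr (.inr (.inl i)) : σ)) (F r r' l))
        = eval x (F r r' l) := by
      rw [eval_rename]; rfl
    simp only [f, T, U, C, map_sub, map_sum, map_mul, eval_X, hx, y, ← hc r r' l]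
    ring
  all_goals simp [f, C, y]

/-- Vectors that are the identity on the pivots carry their free parameters in the remaining
coordinates; these are the unipotent changes `t` and `u` of the block version. -/
theorem exists_vanishing_of_block [DecidableEq A] [DecidableEq B] (e : A ⊕ A' ≃ ι) (g : B ⊕ B' ≃ κ)
    (F : A → B → L → MvPolynomial τ ℂ)
    (h : Fintype.card A * Fintype.card A' + Fintype.card B * Fintype.card B' + Fintype.card τ <
      Fintype.card A * Fintype.card B * Fintype.card L) :
    ∃ P : MvPolynomial (ι × L × κ) ℂ, P ≠ 0 ∧
      ∀ (c : ι × L × κ → ℂ) (a : A → ι → ℂ) (b : B → κ → ℂ) (x : τ → ℂ),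
        (∀ r r', a r (e (.inl r')) = if r' = r then 1 else 0) →
        (∀ r r', b r (g (.inl r')) = if r' = r then 1 else 0) →
        (∀ r r' l, ∑ i, ∑ k, a r i * b r' k * c (i, l, k) = eval x (F r r' l)) →
        eval c P = 0 := by
  obtain ⟨P, hP, hP'⟩ := exists_vanishing_of_block_sum F h
  let E : (A ⊕ A') × L × (B ⊕ B') ≃ ι × L × κ := e.prodCongr ((Equiv.refl L).prodCongr g)
  refine ⟨rename E P, fun h0 => hP (rename_injective _ E.injective (by simpa using h0)), ?_⟩
  intro c a b x ha hb hc
  rw [eval_rename]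
  refine hP' _ (fun r j => a r (e (.inr j))) (fun r j => b r (g (.inr j))) x fun r r' l => ?_
  rw [← hc r r' l, ← e.sum_comp]
  simp_rw [← g.sum_comp]
  simp only [Fintype.sum_sum_type, ha, hb, E, Function.comp_apply, Equiv.prodCongr_apply,
    Prod.map_apply, Equiv.refl_apply, ite_mul, one_mul, zero_mul, Finset.sum_ite_irrel,
    Finset.sum_const_zero, Finset.sum_ite_eq', Finset.mem_univ, if_true, mul_ite, mul_one,
    mul_zero, Finset.sum_add_distrib]
  ring

/-- A subspace has a basis in reduced form with respect to suitable pivots. -/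
theorem exists_pivots {n p : ℕ} (ρ : Submodule ℂ (V n)) (h : Module.finrank ℂ ρ = p) :
    ∃ (e : Fin p ⊕ Fin (n - p) ≃ Fin n) (a : Fin p → V n), (∀ r, a r ∈ ρ) ∧
      ∀ r r', a r (e (.inl r')) = if r' = r then 1 else 0 := by
  let g : Fin n → Module.Dual ℂ ρ := fun j => (LinearMap.proj j).comp ρ.subtype
  obtain ⟨κ, j, hj, hspan, hind⟩ := exists_linearIndependent' ℂ g
  have hfin : Finite κ := Finite.of_injective j hj
  let f : ρ →ₗ[ℂ] (κ → ℂ) := LinearMap.pi fun k => g (j k)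
  -- The selected coordinates span all coordinate functionals on `ρ`, so a vector on which they
  -- vanish is zero.
  have hf : Function.Injective f := by
    rw [injective_iff_map_eq_zero]
    intro x hx
    have hle : Submodule.span ℂ (Set.range g) ≤
        LinearMap.ker (Module.Dual.eval ℂ ρ x) := by
      rw [← hspan, Submodule.span_le]
      rintro _ ⟨k, rfl⟩
      exact congrFun hx k
    ext i
    exact hle (Submodule.subset_span ⟨i, rfl⟩)
  have := Fintype.ofFinite κ
  have h1 : Fintype.card κ ≤ p := by
    have := hind.fintype_card_le_finrank
    rwa [Subspace.dual_finrank_eq, h] at this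
  have h2 : p ≤ Fintype.card κ := by
    have := LinearMap.finrank_le_finrank_of_injective hf
    rwa [h, Module.finrank_fintype_fun_eq_card] at this
  have hcard : Fintype.card κ = p := le_antisymm h1 h2
  have hs : Function.Surjective f :=
    (LinearMap.injective_iff_surjective_of_finrank_eq_finrank
      (by rw [h, Module.finrank_fintype_fun_eq_card, hcard])).1 hf
  classical
  let eκ : Fin p ≃ κ := (Fintype.equivFinOfCardEq hcard).symm
  have hc : Fintype.card ((Set.range j)ᶜ : Set (Fin n)) = n - p := by
    rw [Fintype.card_compl_set, Fintype.card_fin, Set.card_range_of_injective hj, hcard]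
  let e : Fin p ⊕ Fin (n - p) ≃ Fin n :=
    ((eκ.trans (Equiv.ofInjective j hj)).sumCongr (Fintype.equivFinOfCardEq hc).symm).trans
      (Equiv.Set.sumCompl (Set.range j))
  -- The reduced basis is the preimage of the standard basis under the pivot coordinates.
  choose a ha using fun r : Fin p => hs (Pi.single (eκ r) 1)
  refine ⟨e, fun r => a r, fun r => (a r).2, fun r r' => ?_⟩
  have := congrFun (ha r) (eκ r')
  rw [Pi.single_apply] at this
  simpa [f, g, e] using this

/-- Tensors whose restriction to some pair of subspaces of dimensions `p`, `q` is parametrized by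
`τ` lie in a hypersurface if there are few parameters. -/
theorem exists_vanishing_of_subspaces (n N d p q : ℕ)
    (F : Fin p → Fin q → Fin N → MvPolynomial τ ℂ)
    (h : p * (n - p) + q * (d - q) + Fintype.card τ < p * q * N) :
    ∃ P : MvPolynomial (Fin n × Fin N × Fin d) ℂ, P ≠ 0 ∧
      ∀ (c : Fin n × Fin N × Fin d → ℂ) (ρ₁ : Submodule ℂ (V n)) (ρ₂ : Submodule ℂ (V d)),
        Module.finrank ℂ ρ₁ = p → Module.finrank ℂ ρ₂ = q →
        (∀ (a : Fin p → V n) (b : Fin q → V d), (∀ r, a r ∈ ρ₁) → (∀ r, b r ∈ ρ₂) →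
          ∃ x : τ → ℂ, ∀ r r' l, ∑ i, ∑ k, a r i * b r' k * c (i, l, k) = eval x (F r r' l)) →
        eval c P = 0 := by
  choose P hP hP' using fun (e : Fin p ⊕ Fin (n - p) ≃ Fin n) (g : Fin q ⊕ Fin (d - q) ≃ Fin d) =>
    exists_vanishing_of_block e g F (by simpa using h)
  -- The equation depends on the pivots; the product over the finitely many choices covers both
  -- whole Grassmannians.
  refine ⟨∏ e, ∏ g, P e g, ?_, ?_⟩
  · exact Finset.prod_ne_zero_iff.2 fun e _ => Finset.prod_ne_zero_iff.2 fun g _ => hP e g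
  · intro c ρ₁ ρ₂ h₁ h₂ H
    obtain ⟨e, a, ha, ha'⟩ := exists_pivots ρ₁ h₁
    obtain ⟨g, b, hb, hb'⟩ := exists_pivots ρ₂ h₂
    obtain ⟨x, hx⟩ := H a b ha hb
    simp only [map_prod]
    exact Finset.prod_eq_zero (Finset.mem_univ e)
      (Finset.prod_eq_zero (Finset.mem_univ g) (hP' e g c a b x ha' hb' hx))

end Genericity

/-! ### Decomposable forms and the Plücker image of the hyperplanes in a subspace. -/

section Exterior

variable {E : Type*} [AddCommGroup E] [Module ℂ E]

open CliffordAlgebra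

theorem contractLeft_ιMulti_eq_zero (c : Module.Dual ℂ E) {k : ℕ} (w : Fin k → E)
    (hw : ∀ i, c (w i) = 0) :
    contractLeft (Q := (0 : QuadraticForm ℂ E)) c (ExteriorAlgebra.ιMulti ℂ k w) = 0 := by
  induction k with
  | zero => simp
  | succ k ih =>
    rw [ExteriorAlgebra.ιMulti_succ_apply]
    refine (contractLeft_ι_mul (Q := (0 : QuadraticForm ℂ E)) _ _ _).trans ?_
    rw [hw 0, ih (Matrix.vecTail w) fun i => hw _]
    simp

/-- Contraction is an antiderivation, so only the factor on which `c` does not vanish contributes.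
-/
theorem contractLeft_ιMulti_cons (c : Module.Dual ℂ E) {k : ℕ} (v : E) (w : Fin k → E)
    (hv : c v = 1) (hw : ∀ i, c (w i) = 0) :
    contractLeft (Q := (0 : QuadraticForm ℂ E)) c
      (ExteriorAlgebra.ιMulti ℂ (k + 1) (Fin.cons v w)) = ExteriorAlgebra.ιMulti ℂ k w := by
  rw [ExteriorAlgebra.ιMulti_succ_apply]
  refine (contractLeft_ι_mul (Q := (0 : QuadraticForm ℂ E)) _ _ _).trans ?_
  have : Matrix.vecTail (Fin.cons v w : Fin (k + 1) → E) = w := by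
    ext i; simp [Matrix.vecTail]
  rw [this, contractLeft_ιMulti_eq_zero c w hw]
  simp [hv]

/-- Contracting a volume form by a nonzero functional gives a decomposable form spanned by the
kernel of the functional. -/
theorem exists_contractLeft_volume {k : ℕ} (b : Module.Basis (Fin (k + 1)) ℂ E)
    (c : Module.Dual ℂ E) (hc : c ≠ 0) :
    ∃ W : Submodule ℂ E, Module.finrank ℂ W = k ∧
      ∃ ω : ⋀[ℂ]^k E, ω ≠ 0 ∧ ω ∈ LinearMap.range (exteriorPower.map k W.subtype) ∧
        contractLeft (Q := (0 : QuadraticForm ℂ E)) c (ExteriorAlgebra.ιMulti ℂ (k + 1) b) = ω := by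
  have : FiniteDimensional ℂ E := b.finiteDimensional_of_finite
  have hE : Module.finrank ℂ E = k + 1 := by simp [Module.finrank_eq_card_basis b]
  obtain ⟨v, hv⟩ : ∃ v, c v = 1 := by
    obtain ⟨v, hv⟩ : ∃ v, c v ≠ 0 := by
      by_contra! h
      exact hc (LinearMap.ext h)
    exact ⟨(c v)⁻¹ • v, by simp [hv]⟩
  have hW : Module.finrank ℂ (LinearMap.ker c) = k := by
    have := Module.Dual.finrank_ker_add_one_of_ne_zero hc
    omega
  let w : Module.Basis (Fin k) ℂ (LinearMap.ker c) := Module.finBasisOfFinrankEq _ _ hW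
  have hw (i) : c (w i) = 0 := (w i).2
  let w' : Fin k → E := fun i => w i
  have hw' : LinearIndependent ℂ w' :=
    w.linearIndependent.map' (LinearMap.ker c).subtype (Submodule.ker_subtype _)
  have hind : LinearIndependent ℂ (Fin.cons v w' : Fin (k + 1) → E) := by
    refine linearIndependent_finCons.2 ⟨hw', fun hmem => ?_⟩
    have hle : Submodule.span ℂ (Set.range w') ≤ LinearMap.ker c := by
      rw [Submodule.span_le]
      rintro _ ⟨i, rfl⟩
      exact hw i
    have := hle hmem
    rw [LinearMap.mem_ker, hv] at this
    exact one_ne_zero this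
  let e : Module.Basis (Fin (k + 1)) ℂ E :=
    basisOfLinearIndependentOfCardEqFinrank hind (by simp [hE])
  have he : ⇑e = Fin.cons v w' := coe_basisOfLinearIndependentOfCardEqFinrank _ _
  have hdet : e.det b ≠ 0 := (e.isUnit_det b).ne_zero
  -- Top-degree forms are unique up to a scalar, so `b` may be replaced by a basis adapted to `ker
  -- c`.
  have htop : ExteriorAlgebra.ιMulti ℂ (k + 1) b
      = e.det b • ExteriorAlgebra.ιMulti ℂ (k + 1) (Fin.cons v w') := by
    rw [← he]
    suffices h : ExteriorAlgebra.ιMulti ℂ (k + 1) =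
        (LinearMap.toSpanSingleton ℂ (ExteriorAlgebra ℂ E) (ExteriorAlgebra.ιMulti ℂ (k + 1) e)).compAlternatingMap
          e.det from congrArg (fun f => f b) h
    refine e.ext_alternating fun σ hσ => ?_
    obtain ⟨σ, rfl⟩ : ∃ τ : Equiv.Perm (Fin (k + 1)), ⇑τ = σ :=
      ⟨Equiv.ofBijective σ (Finite.injective_iff_bijective.1 hσ), rfl⟩
    change _ = e.det (e ∘ σ) • ExteriorAlgebra.ιMulti ℂ (k + 1) e
    refine ((ExteriorAlgebra.ιMulti ℂ (k + 1)).map_perm e σ).trans ?_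
    rw [AlternatingMap.map_perm, e.det_self, smul_assoc, one_smul]
  refine ⟨LinearMap.ker c, hW, e.det b • exteriorPower.ιMulti ℂ k w', ?_, ?_, ?_⟩
  · refine smul_ne_zero hdet fun h0 => ?_
    -- Pull the vanishing back to `ker c`, where the determinant of the basis `w` detects its volume
    -- form.
    have h1 : exteriorPower.map k (LinearMap.ker c).subtype (exteriorPower.ιMulti ℂ k w) = 0 := by
      rw [exteriorPower.map_apply_ιMulti]
      exact h0
    rw [map_eq_zero_iff _ (exteriorPower.map_injective_field (Submodule.subtype_injective _))] at h1
    have h2 := exteriorPower.alternatingMapLinearEquiv_apply_ιMulti w.det w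
    rw [h1, map_zero, w.det_self] at h2
    exact zero_ne_one h2
  · refine Submodule.smul_mem _ _ ⟨exteriorPower.ιMulti ℂ k w, ?_⟩
    rw [exteriorPower.map_apply_ιMulti]
    rfl
  · rw [htop, map_smul, contractLeft_ιMulti_cons c v w' hv hw]
    rfl

/-- In a space of dimension `k + 1`, every `k`-form is decomposable. -/
theorem exists_mem_range_map_subtype {k : ℕ} (hE : Module.finrank ℂ E = k + 1) (ω : ⋀[ℂ]^k E)
    (hω : ω ≠ 0) :
    ∃ W : Submodule ℂ E, Module.finrank ℂ W = k ∧
      ω ∈ LinearMap.range (exteriorPower.map k W.subtype) := by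
  have : FiniteDimensional ℂ E := Module.finite_of_finrank_pos (by omega)
  let b : Module.Basis (Fin (k + 1)) ℂ E := Module.finBasisOfFinrankEq _ _ hE
  let Φ : Module.Dual ℂ E →ₗ[ℂ] ⋀[ℂ]^k E :=
    LinearMap.codRestrict _ ((contractLeft (Q := (0 : QuadraticForm ℂ E))).flip
      (ExteriorAlgebra.ιMulti ℂ (k + 1) b)) fun c => by
        by_cases hc : c = 0
        · simp [hc]
        · obtain ⟨W, -, ω, -, -, h⟩ := exists_contractLeft_volume b c hc
          rw [LinearMap.flip_apply, h]
          exact ω.2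
  have hΦ (c : Module.Dual ℂ E) (hc : c ≠ 0) : Φ c ≠ 0 ∧ ∃ W : Submodule ℂ E,
      Module.finrank ℂ W = k ∧ Φ c ∈ LinearMap.range (exteriorPower.map k W.subtype) := by
    obtain ⟨W, hW, ω, h0, hmem, h⟩ := exists_contractLeft_volume b c hc
    have : Φ c = ω := Subtype.ext h
    rw [this]
    exact ⟨h0, W, hW, hmem⟩
  have hinj : Function.Injective Φ := by
    rw [injective_iff_map_eq_zero]
    exact fun c h => by_contra fun hc => (hΦ c hc).1 h
  -- Contraction with the volume form is injective between spaces of dimension `k + 1`, so every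
  -- `k`-form arises this way.
  have hsurj : Function.Surjective Φ := by
    refine (LinearMap.injective_iff_surjective_of_finrank_eq_finrank ?_).1 hinj
    rw [Subspace.dual_finrank_eq, exteriorPower.finrank_eq, hE, Nat.choose_succ_self_right]
  obtain ⟨c, rfl⟩ := hsurj ω
  exact (hΦ c fun hc => hω (by rw [hc, map_zero])).2

theorem range_map_subtype_mono {k : ℕ} {W L : Submodule ℂ E} (h : W ≤ L) :
    LinearMap.range (exteriorPower.map k W.subtype) ≤
      LinearMap.range (exteriorPower.map k L.subtype) := by
  rw [← Submodule.subtype_comp_inclusion W L h, exteriorPower.map_comp]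
  exact LinearMap.range_comp_le_range _ _

theorem map_map_subtype_mem_range {E' : Type*} [AddCommGroup E'] [Module ℂ E'] {k : ℕ}
    (f : E →ₗ[ℂ] E') (W : Submodule ℂ E) (η : ⋀[ℂ]^k W) :
    exteriorPower.map k f (exteriorPower.map k W.subtype η) ∈
      LinearMap.range (exteriorPower.map k (W.map f).subtype) := by
  refine ⟨exteriorPower.map k (f.submoduleMap W) η, ?_⟩
  rw [← LinearMap.comp_apply, ← LinearMap.comp_apply, ← exteriorPower.map_comp,
    ← exteriorPower.map_comp]
  rfl

theorem submodule_pluecker {k N : ℕ} (W : Gr k N) :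
    (pluecker W).submodule = LinearMap.range (exteriorPower.map k W.1.subtype) :=
  Projectivization.submodule_mk'' _ _

/-- The hyperplanes in a subspace of dimension `k + 1` form a linear subspace under the Plücker
embedding. -/
theorem isLinearSubspace_pluecker {k N : ℕ} (L : Submodule ℂ (V N))
    (hL : Module.finrank ℂ L = k + 1) :
    IsLinearSubspace k (pluecker '' {W : Gr k N | W.1 ≤ L}) := by
  refine ⟨LinearMap.range (exteriorPower.map k L.subtype), ?_, ?_⟩
  · rw [LinearMap.finrank_range_of_inj
      (exteriorPower.map_injective_field (Submodule.subtype_injective _)),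
      exteriorPower.finrank_eq, hL, Nat.choose_succ_self_right]
  · ext x
    constructor
    · rintro ⟨W, hW, rfl⟩
      change Projectivization.submodule _ ≤ _
      rw [submodule_pluecker]
      exact range_map_subtype_mono hW
    · intro hx
      change x.submodule ≤ _ at hx
      have hrep : x.rep ∈ x.submodule := by
        rw [Projectivization.submodule_eq]
        exact Submodule.mem_span_singleton_self _
      obtain ⟨ω, hω⟩ := hx hrep
      obtain ⟨W, hW, η, hη⟩ := exists_mem_range_map_subtype hL ω fun h0 =>
        x.rep_nonzero (by rw [← hω, h0, map_zero])
      have hW' : Module.finrank ℂ (W.map L.subtype) = k := by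
        rw [Submodule.finrank_map_subtype_eq, hW]
      let W' : Gr k N := ⟨W.map L.subtype, hW'⟩
      refine ⟨W', Submodule.map_subtype_le _ _, ?_⟩
      apply Projectivization.submodule_injective
      rw [submodule_pluecker]
      symm
      refine Submodule.eq_of_le_of_finrank_eq ?_ ?_
      · rw [Projectivization.submodule_eq, Submodule.span_singleton_le_iff_mem, ← hω, ← hη]
        exact map_map_subtype_mem_range L.subtype W η
      · rw [Projectivization.finrank_submodule,
          finrank_range_exteriorPower W']

end Exterior
-- Fibres of `π_Z` and lines in `S` through the span of the forms `aᵗ M_u`.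
section Trilinear

variable {n m s : ℕ}

theorem evalAt_add (φ : LinMatrix n m s) (u v : V (s + 1)) :
    evalAt φ (u + v) = evalAt φ u + evalAt φ v := by
  ext i j
  simp [evalAt]

/-- The trilinear form `ω(a,u,b) = aᵗ M_u b`. -/
def trilinear (φ : LinMatrix n m s) : V n →ₗ[ℂ] V (s + 1) →ₗ[ℂ] Module.Dual ℂ (V (n + m)) :=
  LinearMap.mk₂ ℂ (fun a u => (dotProductBilin ℂ ℂ a).comp (evalAt φ u).mulVecLin)
    (fun a a' u => by ext; simp)
    (fun c a u => by ext; simp)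
    (fun a u u' => by ext; simp [evalAt_add])
    (fun c a u => by ext; simp [evalAt_smul])

theorem trilinear_apply (φ : LinMatrix n m s) (a : V n) (u : V (s + 1)) (b : V (n + m)) :
    trilinear φ a u b = a ⬝ᵥ (evalAt φ u *ᵥ b) := rfl

theorem trilinear_eq_zero_iff (φ : LinMatrix n m s) (a : V n) (u : V (s + 1)) :
    trilinear φ a u = 0 ↔ (evalAt φ u)ᵀ *ᵥ a = 0 := by
  rw [Matrix.mulVec_transpose, ← dotProduct_eq_zero_iff]
  constructor
  · intro h b
    rw [← Matrix.dotProduct_mulVec, ← trilinear_apply, h, LinearMap.zero_apply]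
  · intro h
    ext b
    rw [LinearMap.comp_apply, trilinear_apply, Matrix.dotProduct_mulVec, h]
    rfl

theorem trilinear_single (φ : LinMatrix n m s) (a : V n) (u : V (s + 1)) (l : Fin (n + m)) :
    trilinear φ a u (Pi.single l 1) = ∑ i, ∑ k, a i * u k * coeffs φ (i, l, k) := by
  rw [trilinear_apply, dotProduct]
  refine Finset.sum_congr rfl fun i _ => ?_
  rw [Matrix.mulVec_single_one, Matrix.col_apply, evalAt, Matrix.of_apply,
    LinearMap.pi_apply_eq_sum_univ (φ i l) u, Finset.mul_sum]
  refine Finset.sum_congr rfl fun k _ => ?_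
  have h : (fun j => if k = j then (1 : ℂ) else 0) = Pi.single k 1 := by
    ext j
    simp [Pi.single_apply, eq_comm]
  rw [h, smul_eq_mul, coeffs, mul_assoc]

/-- The linear forms `aᵗ M_u` with `a ∈ ρ₁`, `u ∈ ρ₂`. -/
def forms (φ : LinMatrix n m s) (q : Gr 2 n × Gr 2 (s + 1)) :
    Submodule ℂ (Module.Dual ℂ (V (n + m))) :=
  Submodule.map₂ (trilinear φ) q.1.1 q.2.1

theorem mem_Z_iff (φ : LinMatrix n m s) (P : Gr 2 n × Gr 2 (s + 1) × Gr (n + m - 2) (n + m)) :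
    P ∈ Z φ ↔ P.2.2.1 ≤ (forms φ (P.1, P.2.1)).dualCoannihilator := by
  constructor
  · intro h b hb
    rw [Submodule.mem_dualCoannihilator]
    have hle : forms φ (P.1, P.2.1) ≤ LinearMap.ker (Module.Dual.eval ℂ (V (n + m)) b) :=
      Submodule.map₂_le.2 fun a ha u hu => h a ha u hu b hb
    exact fun f hf => hle hf
  · intro h a ha u hu b hb
    exact (Submodule.mem_dualCoannihilator _).1 (h hb) _ (Submodule.apply_mem_map₂ _ ha hu)

theorem finrank_forms_add (φ : LinMatrix n m s) (q : Gr 2 n × Gr 2 (s + 1)) :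
    Module.finrank ℂ (forms φ q) + Module.finrank ℂ (forms φ q).dualCoannihilator = n + m := by
  rw [Subspace.finrank_add_finrank_dualCoannihilator_eq, Module.finrank_fin_fun]

theorem fibreInPluecker_eq (φ : LinMatrix n m s) (q : Gr 2 n × Gr 2 (s + 1)) :
    fibreInPluecker φ q = pluecker '' {W | W.1 ≤ (forms φ q).dualCoannihilator} := by
  ext x
  constructor
  · rintro ⟨P, rfl, rfl⟩
    exact ⟨P.1.2.2, (mem_Z_iff φ _).1 P.2, rfl⟩
  · rintro ⟨W, hW, rfl⟩
    exact ⟨⟨(q.1, q.2, W), (mem_Z_iff φ _).2 hW⟩, rfl, rfl⟩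

/-- Two independent forms cut the common kernel down to dimension at most `n + m - 2`, so it equals
any subspace of that dimension it contains. -/
theorem piZ_injective (φ : LinMatrix n m s) (h : ∀ q, 2 ≤ Module.finrank ℂ (forms φ q)) :
    Function.Injective (piZ φ) := by
  rintro ⟨⟨a, b, c⟩, hP⟩ ⟨⟨a', b', c'⟩, hP'⟩ heq
  obtain ⟨rfl, rfl⟩ := Prod.mk.inj heq
  have key (W : Gr (n + m - 2) (n + m)) (hW : W.1 ≤ (forms φ (a, b)).dualCoannihilator) :
      W.1 = (forms φ (a, b)).dualCoannihilator := by
    refine Submodule.eq_of_le_of_finrank_le hW ?_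
    have h1 := finrank_forms_add φ (a, b)
    have h2 := h (a, b)
    have h3 : Module.finrank ℂ W.1 = n + m - 2 := W.2
    omega
  have : c = c' :=
    Subtype.ext ((key c ((mem_Z_iff φ _).1 hP)).trans (key c' ((mem_Z_iff φ _).1 hP')).symm)
  subst this
  rfl

theorem exists_linearIndependent_pair_mem {E : Type*} [AddCommGroup E] [Module ℂ E]
    (U : Submodule ℂ E) (h : 1 < Module.finrank ℂ U) :
    ∃ v ∈ U, ∃ w ∈ U, LinearIndependent ℂ ![v, w] := by
  have : Nontrivial U := Module.nontrivial_of_finrank_pos (R := ℂ) (by omega)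
  obtain ⟨v, hv⟩ := exists_ne (0 : U)
  obtain ⟨w, hw⟩ := exists_linearIndependent_pair_of_one_lt_finrank h hv
  exact ⟨v, v.2, w, w.2, LinearIndependent.pair_iff.2 fun a b hab =>
    LinearIndependent.pair_iff.1 hw a b (Subtype.ext hab)⟩

/-- A linear subspace of positive dimension has more than one point. -/
theorem IsLinearSubspace.nontrivial {E : Type*} [AddCommGroup E] [Module ℂ E] {d : ℕ}
    {X : Set (ℙ ℂ E)} (hX : IsLinearSubspace d X) (hd : 1 ≤ d) : X.Nontrivial := by
  obtain ⟨U, hU, rfl⟩ := hX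
  obtain ⟨v, hvU, w, hwU, hvw⟩ := exists_linearIndependent_pair_mem U (by omega)
  have hv : v ≠ 0 := hvw.ne_zero 0
  have hw : w ≠ 0 := hvw.ne_zero 1
  refine ⟨Projectivization.mk ℂ v hv, ?_, Projectivization.mk ℂ w hw, ?_, ?_⟩
  · change Projectivization.submodule _ ≤ _
    rw [Projectivization.submodule_mk, Submodule.span_singleton_le_iff_mem]
    exact hvU
  · change Projectivization.submodule _ ≤ _
    rw [Projectivization.submodule_mk, Submodule.span_singleton_le_iff_mem]
    exact hwU
  · rw [Ne, Projectivization.mk_eq_mk_iff']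
    rintro ⟨c, hc⟩
    have := (LinearIndependent.pair_iff.1 hvw) 1 (-c) (by rw [← hc]; simp)
    exact one_ne_zero this.1

/-- The fibre is linear of dimension `n + m - 2` if and only if the forms span a line. -/
theorem isLinearSubspace_fibre_iff (hn : 3 ≤ n) (φ : LinMatrix n m s)
    (q : Gr 2 n × Gr 2 (s + 1)) (h0 : forms φ q ≠ ⊥) :
    IsLinearSubspace (n + m - 2) (fibreInPluecker φ q) ↔ Module.finrank ℂ (forms φ q) = 1 := by
  have hadd := finrank_forms_add φ q
  rw [fibreInPluecker_eq]
  constructor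
  · intro h
    have hpos : Module.finrank ℂ (forms φ q) ≠ 0 := fun h => h0 (Submodule.finrank_eq_zero.1 h)
    by_contra hne
    -- Since `n ≥ 3`, the linear space has positive dimension, hence two points; with at least two
    -- independent forms the fibre has at most one.
    obtain ⟨_, ⟨W, hW, rfl⟩, _, ⟨W', hW', rfl⟩, hWW'⟩ := h.nontrivial (by omega)
    have key (W : Gr (n + m - 2) (n + m)) (hW : W.1 ≤ (forms φ q).dualCoannihilator) :
        W.1 = (forms φ q).dualCoannihilator := by
      refine Submodule.eq_of_le_of_finrank_le hW ?_
      have h3 : Module.finrank ℂ W.1 = n + m - 2 := W.2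
      omega
    exact hWW' (congrArg pluecker (Subtype.ext ((key W hW).trans (key W' hW').symm)))
  · intro h
    exact isLinearSubspace_pluecker _ (by omega)

theorem finrank_ker_transpose_add_rank (φ : LinMatrix n m s) (u : V (s + 1)) :
    Module.finrank ℂ (LinearMap.ker ((trilinear φ).flip u)) + (evalAt φ u).rank = n := by
  have h : LinearMap.ker ((trilinear φ).flip u) =
      LinearMap.ker (Matrix.mulVecLin (evalAt φ u)ᵀ) := by
    ext a
    simp only [LinearMap.mem_ker, LinearMap.flip_apply, Matrix.mulVecLin_apply]
    exact trilinear_eq_zero_iff φ a u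
  have h3 := LinearMap.finrank_range_add_finrank_ker (Matrix.mulVecLin (evalAt φ u)ᵀ)
  rw [Module.finrank_fin_fun] at h3
  have h4 : (evalAt φ u)ᵀ.rank = (evalAt φ u).rank := Matrix.rank_transpose _
  rw [Matrix.rank] at h4
  rw [h, add_comm, ← h4]
  exact h3

theorem degeneracyLocus_eq_empty_iff (hn : 2 ≤ n) (φ : LinMatrix n m s) :
    degeneracyLocus φ (n - 2) = ∅ ↔
      ∀ u ≠ 0, Module.finrank ℂ (LinearMap.ker ((trilinear φ).flip u)) ≤ 1 := by
  rw [Set.eq_empty_iff_forall_notMem]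
  constructor
  · intro h u hu
    have h1 := finrank_ker_transpose_add_rank φ u
    by_contra h2
    refine h (Projectivization.mk ℂ u hu) fun v hv => ?_
    rw [Projectivization.submodule_mk, Submodule.mem_span_singleton] at hv
    obtain ⟨c, rfl⟩ := hv
    rw [evalAt_smul]
    exact (rank_smul_le _ _).trans (by omega)
  · intro h x hx
    rw [mem_degeneracyLocus_iff] at hx
    have h1 := finrank_ker_transpose_add_rank φ x.rep
    have h2 := h _ x.rep_nonzero
    omega

theorem forms_ne_bot (hn : 2 ≤ n) (φ : LinMatrix n m s) (h : degeneracyLocus φ (n - 2) = ∅)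
    (q : Gr 2 n × Gr 2 (s + 1)) : forms φ q ≠ ⊥ := by
  intro h0
  obtain ⟨u, hu, hu0⟩ : ∃ u ∈ q.2.1, u ≠ 0 := by
    refine Submodule.exists_mem_ne_zero_of_ne_bot fun hb => ?_
    have h2 : Module.finrank ℂ q.2.1 = 2 := q.2.2
    rw [hb, finrank_bot] at h2
    omega
  have hle : q.1.1 ≤ LinearMap.ker ((trilinear φ).flip u) := fun a ha => by
    have : trilinear φ a u ∈ forms φ q := Submodule.apply_mem_map₂ _ ha hu
    rw [h0, Submodule.mem_bot] at this
    exact this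
  have h1 := Submodule.finrank_mono hle
  have h2 := (degeneracyLocus_eq_empty_iff hn φ).1 h u hu0
  have h3 : Module.finrank ℂ q.1.1 = 2 := q.1.2
  omega

theorem rep_mem_iff {E : Type*} [AddCommGroup E] [Module ℂ E] (x : ℙ ℂ E) (U : Submodule ℂ E) :
    x.rep ∈ U ↔ x.submodule ≤ U := by
  rw [Projectivization.submodule_eq, Submodule.span_singleton_le_iff_mem]

theorem mem_kerAt_iff (φ : LinMatrix n m s) (x : PV (s + 1)) (a : V n) :
    a ∈ kerAt φ x ↔ trilinear φ a x.rep = 0 := by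
  rw [kerAt_eq, trilinear_eq_zero_iff, LinearMap.mem_ker, Matrix.mulVecLin_apply]

theorem mem_S_of_mem_kerAt (hn : 1 ≤ n) (φ : LinMatrix n m s) (x : PV (s + 1)) (a : V n)
    (ha : a ≠ 0) (h : a ∈ kerAt φ x) : x ∈ S φ := by
  refine (mem_degeneracyLocus_iff φ _ _).2 ?_
  have h1 := finrank_ker_transpose_add_rank φ x.rep
  have h2 : Module.finrank ℂ (LinearMap.ker ((trilinear φ).flip x.rep)) ≠ 0 := fun h0 =>
    ha ((Submodule.mem_bot ℂ).1 (Submodule.finrank_eq_zero.1 h0 ▸ (mem_kerAt_iff φ x a).1 h))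
  omega

theorem submodule_psi (φ : LinMatrix n m s) (h : degeneracyLocus φ (n - 2) = ∅) (x : S φ) :
    (psi φ h x).submodule = kerAt φ x.1 :=
  Projectivization.submodule_mk'' _ _

theorem submodule_psi_eq_span (φ : LinMatrix n m s) (h : degeneracyLocus φ (n - 2) = ∅)
    (x : S φ) (a : V n) (ha : a ≠ 0) (hx : trilinear φ a x.1.rep = 0) :
    (psi φ h x).submodule = ℂ ∙ a := by
  rw [submodule_psi]
  symm
  refine Submodule.eq_of_le_of_finrank_eq ?_ ?_
  · rwa [Submodule.span_singleton_le_iff_mem, mem_kerAt_iff]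
  · rw [finrank_span_singleton ha, finrank_kerAt φ h x]

/-- If the forms attached to `(ρ₁, ρ₂)` span a line, then `ψ` maps the line `ℙ(ρ₂)` onto the
line `ℙ(ρ₁)`. -/
theorem exists_line_of_finrank_forms (hn : 3 ≤ n) (φ : LinMatrix n m s)
    (h : degeneracyLocus φ (n - 2) = ∅) (q : Gr 2 n × Gr 2 (s + 1))
    (hq : Module.finrank ℂ (forms φ q) = 1) :
    ∃ l : Set (PV (s + 1)), IsLine l ∧ l ⊆ S φ ∧ IsLine (psi φ h '' {x : S φ | x.1 ∈ l}) := by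
  have h1 : Module.finrank ℂ q.1.1 = 2 := q.1.2
  have h2 : Module.finrank ℂ q.2.1 = 2 := q.2.2
  have hmem {a u} (ha : a ∈ q.1.1) (hu : u ∈ q.2.1) : trilinear φ a u ∈ forms φ q :=
    Submodule.apply_mem_map₂ _ ha hu
  -- A linear map from a plane to a line has a kernel. `hleft` puts the image of `ψ` inside `ℙ(ρ₁)`,
  -- and `hright` gives surjectivity.
  have hleft (u) (hu : u ∈ q.2.1) : ∃ a ∈ q.1.1, a ≠ 0 ∧ trilinear φ a u = 0 := by
    let f : q.1.1 →ₗ[ℂ] forms φ q :=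
      (((trilinear φ).flip u).comp q.1.1.subtype).codRestrict _ fun a => hmem a.2 hu
    obtain ⟨a, ha, ha0⟩ := Submodule.exists_mem_ne_zero_of_ne_bot
      (LinearMap.ker_ne_bot_of_finrank_lt (f := f) (by omega))
    exact ⟨a, a.2, fun h => ha0 (Subtype.ext h), congrArg Subtype.val ha⟩
  have hright (a) (ha : a ∈ q.1.1) : ∃ u ∈ q.2.1, u ≠ 0 ∧ trilinear φ a u = 0 := by
    let f : q.2.1 →ₗ[ℂ] forms φ q :=
      ((trilinear φ a).comp q.2.1.subtype).codRestrict _ fun u => hmem ha u.2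
    obtain ⟨u, hu, hu0⟩ := Submodule.exists_mem_ne_zero_of_ne_bot
      (LinearMap.ker_ne_bot_of_finrank_lt (f := f) (by omega))
    exact ⟨u, u.2, fun h => hu0 (Subtype.ext h), congrArg Subtype.val hu⟩
  have hS : {x : PV (s + 1) | x.submodule ≤ q.2.1} ⊆ S φ := by
    intro x hx
    obtain ⟨a, -, ha0, h0⟩ := hleft x.rep ((rep_mem_iff x _).2 hx)
    exact mem_S_of_mem_kerAt (by omega) φ x a ha0 ((mem_kerAt_iff φ x a).2 h0)
  refine ⟨{x | x.submodule ≤ q.2.1}, ⟨q.2.1, h2, rfl⟩, hS, q.1.1, h1, ?_⟩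
  ext y
  constructor
  · rintro ⟨x, hx, rfl⟩
    obtain ⟨a, ha, ha0, h0⟩ := hleft x.1.rep ((rep_mem_iff x.1 _).2 hx)
    change Projectivization.submodule _ ≤ _
    rwa [submodule_psi_eq_span φ h x a ha0 h0, Submodule.span_singleton_le_iff_mem]
  · intro hy
    obtain ⟨u, hu, hu0, h0⟩ := hright y.rep ((rep_mem_iff y _).2 hy)
    let x : PV (s + 1) := Projectivization.mk ℂ u hu0
    have hx : x.submodule ≤ q.2.1 := by
      rwa [Projectivization.submodule_mk, Submodule.span_singleton_le_iff_mem]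
    have hx0 : trilinear φ y.rep x.rep = 0 := by
      obtain ⟨c, hc⟩ := Projectivization.exists_smul_eq_mk_rep ℂ u hu0
      rw [← hc, Units.smul_def, map_smul, h0, smul_zero]
    refine ⟨⟨x, hS hx⟩, hx, Projectivization.submodule_injective ?_⟩
    rw [submodule_psi_eq_span φ h ⟨x, hS hx⟩ y.rep y.rep_nonzero hx0,
      Projectivization.submodule_eq]

theorem exists_mem_span_singleton_of_smul_add_smul {E : Type*} [AddCommGroup E] [Module ℂ E]
    {p q : ℂ} {x y : E} (hpq : p ≠ 0 ∨ q ≠ 0) (h : p • x + q • y = 0) :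
    ∃ g, x ∈ ℂ ∙ g ∧ y ∈ ℂ ∙ g := by
  wlog hp : p ≠ 0 generalizing p q x y
  · obtain ⟨g, hx, hy⟩ := this hpq.symm (by rwa [add_comm]) (hpq.resolve_left hp)
    exact ⟨g, hy, hx⟩
  · refine ⟨y, Submodule.mem_span_singleton.2 ⟨-(p⁻¹ * q), ?_⟩, Submodule.mem_span_singleton_self _⟩
    have h1 : p • x = -(q • y) := eq_neg_of_add_eq_zero_left h
    rw [← inv_smul_smul₀ hp x, h1, neg_smul, mul_smul, smul_neg]

/-- If `ψ` maps a line `ℙ(ρ₂)` onto a line `ℙ(ρ₁)`, then the forms attached to `(ρ₁, ρ₂)` span at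
most a line. -/
theorem exists_finrank_forms_of_line (φ : LinMatrix n m s)
    (h : degeneracyLocus φ (n - 2) = ∅) (l : Set (PV (s + 1))) (hl : IsLine l) (hlS : l ⊆ S φ)
    (hψ : IsLine (psi φ h '' {x : S φ | x.1 ∈ l})) :
    ∃ q, Module.finrank ℂ (forms φ q) ≤ 1 := by
  obtain ⟨_, ⟨P, hP, rfl⟩, _, ⟨Q, hQ, rfl⟩, hPQ⟩ := hψ.nontrivial le_rfl
  obtain ⟨ρ₂, h2, rfl⟩ := hl
  obtain ⟨ρ₁, h1, hρ₁⟩ := hψ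
  have hindV : LinearIndependent ℂ ![P.1.rep, Q.1.rep] :=
    Projectivization.linearIndependent_pair_iff_ne.2 fun hne =>
      hPQ (congrArg _ (Subtype.ext hne))
  have hindA : LinearIndependent ℂ ![(psi φ h P).rep, (psi φ h Q).rep] :=
    Projectivization.linearIndependent_pair_iff_ne.2 hPQ
  have hrep (x : S φ) (hx : x.1.submodule ≤ ρ₂) : (psi φ h x).rep ∈ ρ₁ := by
    rw [rep_mem_iff]
    have : psi φ h x ∈ psi φ h '' {x : S φ | x.1 ∈ {x | x.submodule ≤ ρ₂}} := ⟨x, hx, rfl⟩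
    rwa [hρ₁] at this
  have hker (x : S φ) : trilinear φ (psi φ h x).rep x.1.rep = 0 := by
    rw [← mem_kerAt_iff, ← submodule_psi φ h, rep_mem_iff]
  have hspan {N : ℕ} (ρ : Submodule ℂ (V N)) (hρ : Module.finrank ℂ ρ = 2) (v w : V N)
      (hv : v ∈ ρ) (hw : w ∈ ρ) (hvw : LinearIndependent ℂ ![v, w]) :
      Submodule.span ℂ {v, w} = ρ := by
    refine Submodule.eq_of_le_of_finrank_eq ?_ ?_
    · rw [Submodule.span_le]
      rintro _ (rfl | rfl) <;> assumption
    · have := finrank_span_eq_card hvw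
      rw [Matrix.range_cons, Matrix.range_cons, Matrix.range_empty, Set.union_empty,
        Set.singleton_union] at this
      rw [this, hρ, Fintype.card_fin]
  have hV := hspan ρ₂ h2 _ _ ((rep_mem_iff _ _).2 hP) ((rep_mem_iff _ _).2 hQ) hindV
  have hA := hspan ρ₁ h1 _ _ (hrep P hP) (hrep Q hQ) hindA
  have hPV : P.1.rep ∈ ρ₂ := (rep_mem_iff _ _).2 hP
  have hQV : Q.1.rep ∈ ρ₂ := (rep_mem_iff _ _).2 hQ
  have hkP := hker P
  have hkQ := hker Q
  set u₁ := P.1.rep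
  set u₂ := Q.1.rep
  set a₁ := (psi φ h P).rep
  set a₂ := (psi φ h Q).rep
  -- A third point of the line, on which both mixed terms `a₁ u₂` and `a₂ u₁` are visible.
  have hu0 : u₁ + u₂ ≠ 0 := fun h0 => by
    have := (LinearIndependent.pair_iff.1 hindV) 1 1 (by simpa using h0)
    exact one_ne_zero this.1
  have hR : (Projectivization.mk ℂ _ hu0).submodule ≤ ρ₂ := by
    rw [Projectivization.submodule_mk, Submodule.span_singleton_le_iff_mem]
    exact add_mem hPV hQV
  let R : S φ := ⟨Projectivization.mk ℂ _ hu0, hlS hR⟩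
  obtain ⟨p, q, hpq⟩ := Submodule.mem_span_pair.1 (hA ▸ hrep R hR)
  have hkR : trilinear φ (psi φ h R).rep (u₁ + u₂) = 0 := by
    obtain ⟨c, hc⟩ := Projectivization.exists_smul_eq_mk_rep ℂ _ hu0
    have := hker R
    rw [← hc, Units.smul_def, map_smul] at this
    exact (smul_eq_zero.1 this).resolve_left c.ne_zero
  have hne : p ≠ 0 ∨ q ≠ 0 := by
    by_contra! h0
    refine (psi φ h R).rep_nonzero ?_
    rw [← hpq, h0.1, h0.2]
    simp
  -- Expand at `(p a₁ + q a₂, u₁ + u₂)`; the diagonal terms vanish because `aᵢ` lies in the kernel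
  -- at `uᵢ`.
  have hrel : p • trilinear φ a₁ u₂ + q • trilinear φ a₂ u₁ = 0 := by
    rw [← hpq] at hkR
    simpa [hkP, hkQ] using hkR
  obtain ⟨g, hg₁, hg₂⟩ := exists_mem_span_singleton_of_smul_add_smul hne hrel
  refine ⟨(⟨ρ₁, h1⟩, ⟨ρ₂, h2⟩), ?_⟩
  have hle : forms φ (⟨ρ₁, h1⟩, ⟨ρ₂, h2⟩) ≤ ℂ ∙ g := by
    change Submodule.map₂ (trilinear φ) ρ₁ ρ₂ ≤ _
    rw [← hA, ← hV, Submodule.map₂_span_span, Submodule.span_le]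
    rintro _ ⟨a, (rfl | rfl), u, (rfl | rfl), rfl⟩
    · simp [a₁, u₁, hkP]
    · exact hg₁
    · exact hg₂
    · simp [a₂, u₂, hkQ]
  exact (Submodule.finrank_mono hle).trans (by simpa using finrank_span_le_card (R := ℂ) {g})

end Trilinear

/-! ### The two genericity statements. -/

section General

variable {n m s : ℕ}

open MvPolynomial

/-- A point of `D_{n-2}` gives a plane `ρ₁` and a line `ρ₂` on which the tensor vanishes. The choice
costs `2(n-2) + s` parameters against `2(n+m)` equations, and `s < 2m + 4`. The zero block needs no
parameters, hence `τ = Empty`. -/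
theorem forGeneral_degeneracyLocus_eq_empty (hn : 3 ≤ n) (hs : s ≤ 2 * m + 3) :
    ForGeneral fun φ : LinMatrix n m s => degeneracyLocus φ (n - 2) = ∅ := by
  obtain ⟨P, hP, hP'⟩ := exists_vanishing_of_subspaces (τ := Empty) n (n + m) (s + 1) 2 1
    (fun _ _ _ => 0) (by
      simp only [Fintype.card_empty, add_tsub_cancel_right]
      omega)
  refine ⟨P, hP, fun φ hφ => ?_⟩
  refine (degeneracyLocus_eq_empty_iff (by omega) φ).2 ?_
  intro u hu
  by_contra! hlt
  obtain ⟨v, hv, w, hw, hvw⟩ := exists_linearIndependent_pair_mem _ hlt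
  have hρ : Submodule.span ℂ (Set.range ![v, w]) ≤ LinearMap.ker ((trilinear φ).flip u) := by
    rw [Submodule.span_le]
    rintro _ ⟨i, rfl⟩
    fin_cases i
    exacts [hv, hw]
  refine hφ (hP' _ _ (ℂ ∙ u) (finrank_span_eq_card hvw) (finrank_span_singleton hu) fun a b ha hb =>
    ⟨Empty.elim, fun r r' l => ?_⟩)
  rw [← trilinear_single, map_zero]
  obtain ⟨c, hc⟩ := Submodule.mem_span_singleton.1 (hb r')
  have : trilinear φ (a r) u = 0 := hρ (ha r)
  rw [← hc, map_smul, this, smul_zero, LinearMap.zero_apply]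

/-- If the forms span at most a line, the restricted tensor is `B ⊗ f` with `B` a `2 × 2` matrix and
`f` a functional. This leaves `2(n-2) + 2(s-1) + 4 + (n+m)` parameters against `4(n+m)` entries.
Rescaling `B` against `f` is counted once too often, but the bound in (1) leaves room for it. -/
theorem forGeneral_two_le_finrank_forms (h : 2 * s < n + 3 * m + 2)
    (hn : 3 ≤ n) (hs : 1 ≤ s) :
    ForGeneral fun φ : LinMatrix n m s => ∀ q, 2 ≤ Module.finrank ℂ (forms φ q) := by
  obtain ⟨P, hP, hP'⟩ := exists_vanishing_of_subspaces (τ := (Fin 2 × Fin 2) ⊕ Fin (n + m))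
    n (n + m) (s + 1) 2 2 (fun r r' l => X (.inl (r, r')) * X (.inr l)) (by
      simp only [Fintype.card_sum, Fintype.card_prod, Fintype.card_fin]
      omega)
  refine ⟨P, hP, fun φ hφ q => ?_⟩
  by_contra! hlt
  obtain ⟨f, hf⟩ := finrank_le_one_iff.1 (Nat.le_of_lt_succ hlt)
  refine hφ (hP' _ q.1.1 q.2.1 q.1.2 q.2.2 fun a b ha hb => ?_)
  choose B hB using fun r r' =>
    hf ⟨trilinear φ (a r) (b r'), Submodule.apply_mem_map₂ _ (ha r) (hb r')⟩
  refine ⟨Sum.elim (fun t => B t.1 t.2) fun l => f.1 (Pi.single l 1), fun r r' l => ?_⟩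
  have : trilinear φ (a r) (b r') = B r r' • f.1 := (congrArg Subtype.val (hB r r')).symm
  rw [← trilinear_single, this]
  simp

theorem ForGeneral.and {P Q : LinMatrix n m s → Prop} (hP : ForGeneral P) (hQ : ForGeneral Q) :
    ForGeneral fun φ => P φ ∧ Q φ := by
  obtain ⟨p, hp, hp'⟩ := hP
  obtain ⟨q, hq, hq'⟩ := hQ
  refine ⟨p * q, mul_ne_zero hp hq, fun φ h => ?_⟩
  rw [map_mul] at h
  exact ⟨hp' φ (left_ne_zero_of_mul h), hq' φ (right_ne_zero_of_mul h)⟩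

theorem ForGeneral.mono {P Q : LinMatrix n m s → Prop} (hP : ForGeneral P)
    (h : ∀ φ, P φ → Q φ) : ForGeneral Q :=
  let ⟨p, hp, hp'⟩ := hP
  ⟨p, hp, fun φ hφ => h φ (hp' φ hφ)⟩

end General

end HilbSq

theorem mainTheorem5 (n m s : ℕ) (hn : 3 ≤ n) (hs : m + 2 ≤ s) (hs' : s ≤ 2 * m + 3) :
    HilbSq.ForGeneral (fun φ : HilbSq.LinMatrix n m s =>
      ∃ h : HilbSq.degeneracyLocus φ (n - 2) = ∅,
        ((n : ℤ) > 2 * s - 3 * m - 1 → Function.Injective (HilbSq.piZ φ)) ∧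
        ((∃ l : Set (HilbSq.PV (s + 1)), HilbSq.IsLine l ∧ l ⊆ HilbSq.S φ ∧
            HilbSq.IsLine (HilbSq.psi φ h '' {x : HilbSq.S φ | x.1 ∈ l})) ↔
          ∃ q : HilbSq.Gr 2 n × HilbSq.Gr 2 (s + 1),
            HilbSq.IsLinearSubspace (n + m - 2) (HilbSq.fibreInPluecker φ q))) := by
  have hinj : HilbSq.ForGeneral fun φ : HilbSq.LinMatrix n m s =>
      (n : ℤ) > 2 * s - 3 * m - 1 → Function.Injective (HilbSq.piZ φ) := by
    by_cases h : (n : ℤ) > 2 * s - 3 * m - 1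
    · exact (HilbSq.forGeneral_two_le_finrank_forms (by omega) hn (by omega)).mono
        fun φ hφ _ => HilbSq.piZ_injective φ hφ
    -- Without the numerical bound the implication is vacuous, so the open set can be the whole
    -- space.
    · exact ⟨1, one_ne_zero, fun φ _ h' => absurd h' h⟩
  refine ((HilbSq.forGeneral_degeneracyLocus_eq_empty hn hs').and hinj).mono ?_
  rintro φ ⟨h, h1⟩
  have h0 := HilbSq.forms_ne_bot (by omega) φ h
  refine ⟨h, h1, ?_, ?_⟩
  · rintro ⟨l, hl, hlS, hψ⟩
    obtain ⟨q, hq⟩ := HilbSq.exists_finrank_forms_of_line φ h l hl hlS hψ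
    refine ⟨q, (HilbSq.isLinearSubspace_fibre_iff hn φ q (h0 q)).2 (le_antisymm hq ?_)⟩
    exact Nat.one_le_iff_ne_zero.2 fun h => h0 q (Submodule.finrank_eq_zero.1 h)
  · rintro ⟨q, hq⟩
    exact HilbSq.exists_line_of_finrank_forms hn φ h q
      ((HilbSq.isLinearSubspace_fibre_iff hn φ q (h0 q)).1 hq)
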